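/- For a monic polynomial $p\in\mathbb{C}[x]$ of degree $d$, a point $z=(z_1,\dots,z_d)\in\mathbb{C}^d$ and $1\le i\le d$, put $$q_i(x)=\frac{p(x)}{\prod_{j\neq i}(x-z_j)},\qquad z_i'=z_i-\frac{q_i(z_i)}{q_i'(z_i)}.$$ The Jacobi variant of the Ehrlich–Aberth method for $p$ is the map $\operatorname{JEA}_p\colon z\mapsto(z_1',\dots,z_d')$; we regard it as defined at $z$ if the coordinates of $z$ are pairwise distinct and $q_i'(z_i)\neq0$ for all $i$. Theorem. For every integer $d\ge 4$ there is a monic polynomial $p\in\mathbb{C}[x]$ of degree $d$ with $d$ distinct roots such that $\operatorname{JEA}_p$ has an infinite orbit in $\mathbb{C}^d$ that diverges to infinity: there are points $z^{(n)}\in\mathbb{C}^d$, $n=0,1,2,\dots$, such that for every $n$ the map $\operatorname{JEA}_p$ is defined at $z^{(n)}$ and $\operatorname{JEA}_p(z^{(n)})=z^{(n+1)}$, and $\|z^{(n)}\|\to\infty$ as $n\to\infty$. -/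

import Mathlib

namespace EhrlichAberth

noncomputable section

/-- The rational function `q_i(x) = p(x) / ∏_{j ≠ i} (x - z_j)` of one variable `x`. -/
def q {d : ℕ} (p : Polynomial ℂ) (z : Fin d → ℂ) (i : Fin d) (x : ℂ) : ℂ :=
  p.eval x / ∏ j ∈ Finset.univ.erase i, (x - z j)

/-- The Ehrlich–Aberth update of the `i`-th coordinate: a Newton step for `q_i` at `z_i`. -/
def step {d : ℕ} (p : Polynomial ℂ) (z : Fin d → ℂ) (i : Fin d) : ℂ :=
  z i - q p z i (z i) / deriv (q p z i) (z i)

/-- The Ehrlich–Aberth update of the `i`-th coordinate is defined, with no division by zero: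
`z_i` is no pole of the formula for `q_i`, and `q_i'(z_i) ≠ 0`. -/
def StepDefined {d : ℕ} (p : Polynomial ℂ) (z : Fin d → ℂ) (i : Fin d) : Prop :=
  (∀ j, j ≠ i → z i ≠ z j) ∧ deriv (q p z i) (z i) ≠ 0

/-- The Jacobi variant: all coordinates are updated in parallel. -/
def jacobi {d : ℕ} (p : Polynomial ℂ) (z : Fin d → ℂ) : Fin d → ℂ :=
  fun i => step p z i

/-- `z 0, z 1, z 2, …` is an infinite forward orbit in `ℂ^d` of the Jacobi variant for `p`,
along which every update is defined. -/
def IsJacobiOrbit {d : ℕ} (p : Polynomial ℂ) (z : ℕ → Fin d → ℂ) : Prop :=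
  ∀ n, (∀ i, StepDefined p (z n) i) ∧ z (n + 1) = jacobi p (z n)

end

end EhrlichAberth

/-!
Written in terms of the roots `r_k` of `p`, the Ehrlich–Aberth update `z ↦ w` is the equation
`1 / (z_i - w_i) + ∑_{j ≠ i} 1 / (z_i - z_j) = ∑_k 1 / (z_i - r_k)`, and its two sides have the
same number of terms, so it is invariant under Möbius transformations of `r`, `z` and `w`
together. It therefore suffices to find, for some quartic, an orbit accumulating at a finite
point that it never hits, and to move this point to infinity.

If the roots form an orbit of the Klein four-group generated by `x ↦ -x` and `x ↦ I / x`, then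
the update maps the orbit of `t` to the orbit of a rational function of `t`. For a suitable
choice of the roots this rational function has the attracting cycle `2 ↦ -2 ↦ 2`, which is not
superattracting, so that points close to the cycle converge to it without reaching it.

For larger degrees, a coordinate that sits at a simple root stays there and cancels the
corresponding linear factor from the updates of the other coordinates. So one may adjoin any
new root outside the countable set of points visited so far.
-/

open Polynomial Filter Topology

namespace EhrlichAberth

section MobiusEquivariance

variable {ι K : Type*} [Fintype ι] [Field K]

/-- The Möbius transformation `x ↦ (a x + b) / (c x + e)` on the affine line; it takes the junk
value `0` at the pole. -/
def mobius (a b c e x : K) : K := (a * x + b) / (c * x + e)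

variable {a b c e : K}

theorem mobius_sub_mobius {x y : K} (hx : c * x + e ≠ 0) (hy : c * y + e ≠ 0) :
    mobius a b c e x - mobius a b c e y =
      (a * e - b * c) * (x - y) / ((c * x + e) * (c * y + e)) := by
  rw [mobius, mobius, div_sub_div _ _ hx hy]
  ring

theorem mobius_ne_mobius (hdet : a * e - b * c ≠ 0) {x y : K} (hx : c * x + e ≠ 0)
    (hy : c * y + e ≠ 0) (hxy : x ≠ y) : mobius a b c e x ≠ mobius a b c e y := by
  rw [← sub_ne_zero, mobius_sub_mobius hx hy]
  exact div_ne_zero (mul_ne_zero hdet (sub_ne_zero.2 hxy)) (mul_ne_zero hx hy)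

theorem mobius_comp_injective {α : Type*} {f : α → K} (hdet : a * e - b * c ≠ 0)
    (hf : Function.Injective f) (hpole : ∀ k, c * f k + e ≠ 0) :
    Function.Injective (mobius a b c e ∘ f) := fun i j h => by
  by_contra hij
  exact mobius_ne_mobius hdet (hpole i) (hpole j) (hf.ne hij) h

theorem inv_mobius_sub_mobius (hdet : a * e - b * c ≠ 0) {x y : K} (hx : c * x + e ≠ 0)
    (hy : c * y + e ≠ 0) (hxy : x ≠ y) :
    (mobius a b c e x - mobius a b c e y)⁻¹ =
      (c * x + e) ^ 2 / (a * e - b * c) * (x - y)⁻¹ - c * (c * x + e) / (a * e - b * c) := by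
  have hsub := sub_ne_zero.2 hxy
  rw [mobius_sub_mobius hx hy, inv_div, ← div_eq_mul_inv, div_div,
    div_sub_div _ _ (mul_ne_zero hdet hsub) hdet,
    div_eq_div_iff (mul_ne_zero hdet hsub) (mul_ne_zero (mul_ne_zero hdet hsub) hdet)]
  ring

theorem sum_inv_mobius_sub_mobius (hdet : a * e - b * c ≠ 0) {x : K} {s : ι → K}
    (hx : c * x + e ≠ 0) (hs : ∀ k, c * s k + e ≠ 0) (hxs : ∀ k, x ≠ s k) :
    ∑ k, (mobius a b c e x - mobius a b c e (s k))⁻¹ =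
      (c * x + e) ^ 2 / (a * e - b * c) * ∑ k, (x - s k)⁻¹ -
        Fintype.card ι * (c * (c * x + e) / (a * e - b * c)) := by
  simp only [inv_mobius_sub_mobius hdet hx (hs _) (hxs _), Finset.sum_sub_distrib,
    ← Finset.mul_sum, Finset.sum_const, Finset.card_univ, nsmul_eq_mul]

theorem sum_inv_mobius_sub_congr (hdet : a * e - b * c ≠ 0) {x : K} {r s : ι → K}
    (hx : c * x + e ≠ 0) (hr : ∀ k, c * r k + e ≠ 0) (hs : ∀ k, c * s k + e ≠ 0)
    (hxr : ∀ k, x ≠ r k) (hxs : ∀ k, x ≠ s k) (h : ∑ k, (x - r k)⁻¹ = ∑ k, (x - s k)⁻¹) :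
    ∑ k, (mobius a b c e x - mobius a b c e (r k))⁻¹ =
      ∑ k, (mobius a b c e x - mobius a b c e (s k))⁻¹ := by
  rw [sum_inv_mobius_sub_mobius hdet hx hr hxr, sum_inv_mobius_sub_mobius hdet hx hs hxs, h]

variable [DecidableEq ι]

/-- The equation `q_i'(z_i) / q_i(z_i) = 1 / (z_i - w_i)`, which says that `w_i` is the `i`-th
coordinate of the Ehrlich–Aberth image of `z` for the polynomial with roots `r`. The term
`1 / (z_i - w_i)` takes the place of the missing `j = i` in `∑_{j ≠ i} 1 / (z_i - z_j)`, so that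
both sides have the same number of terms. -/
def AberthEq (r z w : ι → K) (i : ι) : Prop :=
  ∑ k, (z i - r k)⁻¹ = ∑ k, (z i - Function.update z i (w i) k)⁻¹

/-- `w` is the Ehrlich–Aberth image of `z` for the polynomial with roots `r`, at a point `z`
whose coordinates are distinct, are no roots and all move. -/
structure AberthStep (r z w : ι → K) : Prop where
  injective : Function.Injective z
  ne_root (i k : ι) : z i ≠ r k
  ne_next (i : ι) : z i ≠ w i
  aberthEq (i : ι) : AberthEq r z w i

theorem ne_update_self {α β : Type*} [DecidableEq α] {f : α → β} (hf : Function.Injective f)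
    {i : α} {y : β} (hy : f i ≠ y) (k : α) : f i ≠ Function.update f i y k := by
  rcases eq_or_ne k i with rfl | hk
  · rwa [Function.update_self]
  · rw [Function.update_of_ne hk]
    exact hf.ne hk.symm

theorem AberthStep.mobius {r z w : ι → K} (h : AberthStep r z w) (hdet : a * e - b * c ≠ 0)
    (hr : ∀ k, c * r k + e ≠ 0) (hz : ∀ k, c * z k + e ≠ 0) (hw : ∀ k, c * w k + e ≠ 0) :
    AberthStep (mobius a b c e ∘ r) (mobius a b c e ∘ z) (mobius a b c e ∘ w) where
  injective := mobius_comp_injective hdet h.injective hz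
  ne_root i k := mobius_ne_mobius hdet (hz i) (hr k) (h.ne_root i k)
  ne_next i := mobius_ne_mobius hdet (hz i) (hw i) (h.ne_next i)
  aberthEq i := by
    have hupdate : ∀ k, c * Function.update z i (w i) k + e ≠ 0 :=
      Function.forall_update_iff z (p := fun _ y => c * y + e ≠ 0) |>.2 ⟨hw i, fun k _ => hz k⟩
    simpa only [AberthEq, Function.comp_apply, ← Function.comp_update] using
      sum_inv_mobius_sub_congr hdet (hz i) hr hupdate (h.ne_root i)
        (ne_update_self h.injective (h.ne_next i)) (h.aberthEq i)

theorem AberthEq.of_mobius_symm {r z w : ι → K} {i : ι} {σ : Equiv.Perm ι}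
    (h : AberthEq r z w i) (hdet : a * e - b * c ≠ 0) (hr : ∀ k, c * r k + e ≠ 0)
    (hz : ∀ k, c * z k + e ≠ 0) (hw : c * w i + e ≠ 0) (hrσ : ∀ k, mobius a b c e (r k) = r (σ k))
    (hzσ : ∀ k, mobius a b c e (z k) = z (σ k)) (hwσ : mobius a b c e (w i) = w (σ i))
    (hinj : Function.Injective z) (hne_root : ∀ k, z i ≠ r k) (hne_next : z i ≠ w i) :
    AberthEq r z w (σ i) := by
  have hupdate : ∀ k, c * Function.update z i (w i) k + e ≠ 0 :=
    Function.forall_update_iff z (p := fun _ y => c * y + e ≠ 0) |>.2 ⟨hw, fun k _ => hz k⟩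
  have hupdateσ (k : ι) : mobius a b c e (Function.update z i (w i) k) =
      Function.update z (σ i) (w (σ i)) (σ k) := by
    rcases eq_or_ne k i with rfl | hk
    · simp only [Function.update_self, hwσ]
    · simp only [Function.update_of_ne hk, Function.update_of_ne (σ.injective.ne hk), hzσ]
  have := sum_inv_mobius_sub_congr hdet (hz i) hr hupdate hne_root
    (ne_update_self hinj hne_next) h
  simp only [hzσ, hrσ, hupdateσ] at this
  rwa [Equiv.sum_comp σ fun k => (z (σ i) - r k)⁻¹,
    Equiv.sum_comp σ fun k => (z (σ i) - Function.update z (σ i) (w (σ i)) k)⁻¹] at this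

end MobiusEquivariance

section NewtonStep

variable {d : ℕ} {p : ℂ[X]} {z : Fin d → ℂ} {i : Fin d}

theorem prod_erase_sub_ne_zero (hz : ∀ j, j ≠ i → z i ≠ z j) :
    ∏ j ∈ Finset.univ.erase i, (z i - z j) ≠ 0 :=
  Finset.prod_ne_zero_iff.2 fun j hj => sub_ne_zero.2 (hz j (Finset.ne_of_mem_erase hj))

theorem logDeriv_prod_sub {ι : Type*} (s : Finset ι) (f : ι → ℂ) {x : ℂ}
    (hx : ∀ k ∈ s, x - f k ≠ 0) :
    logDeriv (fun y => ∏ k ∈ s, (y - f k)) x = ∑ k ∈ s, (x - f k)⁻¹ := by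
  rw [logDeriv_prod hx fun k _ => by fun_prop]
  simp [logDeriv_apply]

theorem logDeriv_q (hz : ∀ j, j ≠ i → z i ≠ z j) (hp : p.eval (z i) ≠ 0) :
    logDeriv (q p z i) (z i) =
      logDeriv (fun x => p.eval x) (z i) - ∑ j ∈ Finset.univ.erase i, (z i - z j)⁻¹ := by
  have hden := prod_erase_sub_ne_zero hz
  unfold q
  rw [logDeriv_div (z i) hp hden p.differentiableAt (by fun_prop), logDeriv_prod_sub]
  exact fun j hj => sub_ne_zero.2 (hz j (Finset.ne_of_mem_erase hj))

theorem stepDefined_and_step_eq_of_logDeriv_q {w : ℂ} (hz : ∀ j, j ≠ i → z i ≠ z j)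
    (hp : p.eval (z i) ≠ 0) (hw : z i ≠ w) (h : logDeriv (q p z i) (z i) = (z i - w)⁻¹) :
    StepDefined p z i ∧ step p z i = w := by
  have hq : q p z i (z i) ≠ 0 := div_ne_zero hp (prod_erase_sub_ne_zero hz)
  have hderiv : deriv (q p z i) (z i) = q p z i (z i) / (z i - w) := by
    rw [logDeriv_apply, div_eq_iff hq] at h
    rw [h, inv_mul_eq_div]
  refine ⟨⟨hz, hderiv ▸ div_ne_zero hq (sub_ne_zero.2 hw)⟩, ?_⟩
  rw [step, hderiv, div_div_cancel₀ hq, sub_sub_cancel]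

theorem AberthStep.stepDefined_and_step_eq {r w : Fin d → ℂ} (h : AberthStep r z w)
    (i : Fin d) :
    StepDefined (∏ k, (X - C (r k))) z i ∧ step (∏ k, (X - C (r k))) z i = w i := by
  have hz : ∀ j, j ≠ i → z i ≠ z j := fun j hj => h.injective.ne hj.symm
  have heval (x : ℂ) : (∏ k, (X - C (r k))).eval x = ∏ k, (x - r k) := by
    simp [eval_prod]
  have hp : (∏ k, (X - C (r k))).eval (z i) ≠ 0 := by
    rw [heval]
    exact Finset.prod_ne_zero_iff.2 fun k _ => sub_ne_zero.2 (h.ne_root i k)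
  have hsum : ∑ k, (z i - Function.update z i (w i) k)⁻¹ =
      (z i - w i)⁻¹ + ∑ j ∈ Finset.univ.erase i, (z i - z j)⁻¹ := by
    rw [← Finset.add_sum_erase _ _ (Finset.mem_univ i), Function.update_self]
    congr 1
    exact Finset.sum_congr rfl fun j hj => by
      rw [Function.update_of_ne (Finset.ne_of_mem_erase hj)]
  refine stepDefined_and_step_eq_of_logDeriv_q hz hp (h.ne_next i) ?_
  simp only [logDeriv_q hz hp, heval]
  rw [logDeriv_prod_sub _ _ fun k _ => sub_ne_zero.2 (h.ne_root i k), h.aberthEq i, hsum,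
    add_sub_cancel_right]

theorem isJacobiOrbit_of_aberthStep {r : Fin d → ℂ} {z : ℕ → Fin d → ℂ}
    (h : ∀ n, AberthStep r (z n) (z (n + 1))) : IsJacobiOrbit (∏ k, (X - C (r k))) z :=
  fun n => ⟨fun i => ((h n).stepDefined_and_step_eq i).1,
    funext fun i => ((h n).stepDefined_and_step_eq i).2.symm⟩

theorem step_eq_self_of_isRoot (h : p.IsRoot (z i)) : step p z i = z i := by
  simp [step, q, h.eq_zero]

theorem stepDefined_of_isRoot (hz : ∀ j, j ≠ i → z i ≠ z j) (h : p.IsRoot (z i))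
    (h' : p.derivative.eval (z i) ≠ 0) : StepDefined p z i := by
  have hden := prod_erase_sub_ne_zero hz
  have hderiv := (p.hasDerivAt (z i)).div
    (DifferentiableAt.hasDerivAt (f := fun x => ∏ j ∈ Finset.univ.erase i, (x - z j))
      (by fun_prop)) hden
  refine ⟨hz, ?_⟩
  change deriv ((fun x => p.eval x) / fun x => ∏ j ∈ Finset.univ.erase i, (x - z j)) (z i) ≠ 0
  rw [hderiv.deriv, h.eq_zero, zero_mul, sub_zero]
  exact div_ne_zero (mul_ne_zero h' hden) (pow_ne_zero 2 hden)

end NewtonStep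

section AdjoinRoot

variable {d : ℕ} {p : ℂ[X]} {a : ℂ}

theorem q_mul_X_sub_C_cons_succ (p : ℂ[X]) (z : Fin d → ℂ) (i : Fin d) {x : ℂ} (hx : x ≠ a) :
    q (p * (X - C a)) (Fin.cons a z : Fin (d + 1) → ℂ) i.succ x = q p z i x := by
  have herase : (Finset.univ.erase i.succ : Finset (Fin (d + 1))) =
      Finset.cons 0 ((Finset.univ.erase i).map (Fin.succEmb d)) (by simp [Fin.succ_ne_zero]) := by
    rw [Fin.univ_succ, Finset.erase_cons_of_ne _ (Fin.succ_ne_zero i).symm]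
    simp only [Finset.map_erase]
    rfl
  rw [q, q, herase, Finset.prod_cons, Finset.prod_map]
  simp only [Fin.cons_zero, Fin.coe_succEmb, Fin.cons_succ, eval_mul, eval_sub, eval_X, eval_C]
  rw [mul_comm (eval x p), mul_div_mul_left _ _ (sub_ne_zero.2 hx)]

theorem deriv_q_mul_X_sub_C_cons_succ (p : ℂ[X]) (z : Fin d → ℂ) (i : Fin d) {x : ℂ}
    (hx : x ≠ a) :
    deriv (q (p * (X - C a)) (Fin.cons a z : Fin (d + 1) → ℂ) i.succ) x = deriv (q p z i) x := by
  refine EventuallyEq.deriv_eq ?_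
  filter_upwards [isOpen_ne.mem_nhds hx] with y hy
  exact q_mul_X_sub_C_cons_succ p z i hy

theorem IsJacobiOrbit.cons {z : ℕ → Fin d → ℂ} (h : IsJacobiOrbit p z) (hp : p.eval a ≠ 0)
    (hz : ∀ n i, z n i ≠ a) :
    IsJacobiOrbit (p * (X - C a)) (fun n => (Fin.cons a (z n) : Fin (d + 1) → ℂ)) := by
  have hroot : (p * (X - C a)).IsRoot a := by simp
  refine fun n => ⟨Fin.cases ?_ fun i => ⟨?_, ?_⟩, funext (Fin.cases ?_ fun i => ?_)⟩
  · refine stepDefined_of_isRoot (Fin.cases (by simp) fun j _ => ?_) (by simp) (by simpa using hp)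
    simpa using (hz n j).symm
  · refine Fin.cases (fun _ => by simpa using hz n i) fun j hj => ?_
    simpa using ((h n).1 i).1 j fun e => hj (congrArg Fin.succ e)
  · simpa [deriv_q_mul_X_sub_C_cons_succ _ _ _ (hz n i)] using ((h n).1 i).2
  · exact (step_eq_self_of_isRoot (z := Fin.cons a (z n)) (i := 0) hroot).symm
  · simp only [Fin.cons_succ, jacobi, step]
    rw [q_mul_X_sub_C_cons_succ _ _ _ (hz n i),
      deriv_q_mul_X_sub_C_cons_succ _ _ _ (hz n i), (h n).2]
    rfl

/-- The Jacobi variant for `p` has an infinite orbit in `ℂ^d` diverging to infinity. -/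
def HasDivergentOrbit (d : ℕ) (p : ℂ[X]) : Prop :=
  ∃ z : ℕ → Fin d → ℂ, IsJacobiOrbit p z ∧ Tendsto (fun n => ‖z n‖) atTop atTop

theorem HasDivergentOrbit.exists_mul_X_sub_C (h : HasDivergentOrbit d p) (hp : p ≠ 0) :
    ∃ a, p.eval a ≠ 0 ∧ HasDivergentOrbit (d + 1) (p * (X - C a)) := by
  obtain ⟨z, hz, hlim⟩ := h
  have hcount : ((Set.range fun x : ℕ × Fin d => z x.1 x.2) ∪ {x | x ∈ p.roots}).Countable :=
    (Set.countable_range _).union p.roots.finite_toSet.countable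
  obtain ⟨a, ha⟩ := (Set.ne_univ_iff_exists_notMem _).1 fun h => not_countable_complex (h ▸ hcount)
  have haz : ∀ n i, z n i ≠ a := fun n i e => ha (Or.inl ⟨(n, i), e⟩)
  have hap : p.eval a ≠ 0 := fun e => ha (Or.inr ((mem_roots hp).2 e))
  refine ⟨a, hap, _, hz.cons hap haz, tendsto_atTop_mono (fun n => ?_) hlim⟩
  refine (pi_norm_le_iff_of_nonneg (norm_nonneg _)).2 fun i => ?_
  simpa using norm_le_pi_norm (Fin.cons a (z n) : Fin (d + 1) → ℂ) i.succ

end AdjoinRoot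

section KleinOrbit

variable {c R s t : ℂ}

/-- The orbit of `t` under the Klein four-group generated by `x ↦ -x` and `x ↦ I / x`. The
order is such that these act on the indices as `Fin.rev` and as addition of `2`. -/
noncomputable def kleinOrbit (t : ℂ) : Fin 4 → ℂ :=
  ![t, -(Complex.I / t), Complex.I / t, -t]

theorem neg_kleinOrbit (t : ℂ) (k : Fin 4) : -kleinOrbit t k = kleinOrbit t k.rev := by
  fin_cases k <;> simp [kleinOrbit, Fin.rev]

theorem I_div_kleinOrbit (t : ℂ) (k : Fin 4) :
    Complex.I / kleinOrbit t k = kleinOrbit t (k + 2) := by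
  fin_cases k <;> simp [kleinOrbit, div_neg, div_div_cancel₀ Complex.I_ne_zero]

theorem kleinOrbit_ne_zero (ht : t ≠ 0) (k : Fin 4) : kleinOrbit t k ≠ 0 := by
  fin_cases k <;> simp [kleinOrbit, ht]

theorem kleinOrbit_apply_injective (k : Fin 4) : Function.Injective (kleinOrbit · k) := by
  intro s t h
  fin_cases k <;> simpa [kleinOrbit, div_eq_mul_inv] using h

theorem kleinOrbit_injective (ht : t ≠ 0) (ht4 : t ^ 4 + 1 ≠ 0) :
    Function.Injective (kleinOrbit t) := by
  have hII := Complex.I_sq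
  have hI : t ≠ Complex.I / t := fun e => ht4 (by
    rw [eq_div_iff ht] at e
    linear_combination (t * t + Complex.I) * e + hII)
  have hI' : t ≠ -(Complex.I / t) := fun e => ht4 (by
    rw [← neg_div, eq_div_iff ht] at e
    linear_combination (t * t - Complex.I) * e + hII)
  have hneg_t : t ≠ -t := self_ne_neg.2 ht
  have hneg_inv : Complex.I / t ≠ -(Complex.I / t) :=
    self_ne_neg.2 (div_ne_zero Complex.I_ne_zero ht)
  intro i j hij
  fin_cases i <;> fin_cases j <;>
    simp only [kleinOrbit, Fin.zero_eta, Fin.mk_one, Fin.reduceFinMk, Matrix.cons_val] at hij ⊢ <;>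
    grind

/-- The invariant `x ^ 2 - x ^ (-2)` of the Klein four-group generated by `x ↦ -x` and
`x ↦ I / x`; the points of `kleinOrbit t` are the roots of
`X ^ 4 - kleinInvariant t * X ^ 2 - 1`. -/
noncomputable def kleinInvariant (t : ℂ) : ℂ := t ^ 2 - (t ^ 2)⁻¹

theorem kleinInvariant_kleinOrbit (t : ℂ) (k : Fin 4) :
    kleinInvariant (kleinOrbit t k) = kleinInvariant t := by
  have hI : (Complex.I / t) ^ 2 - ((Complex.I / t) ^ 2)⁻¹ = t ^ 2 - (t ^ 2)⁻¹ := by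
    rw [div_pow, Complex.I_sq, inv_div]
    ring
  fin_cases k <;> simp [kleinOrbit, kleinInvariant, hI]

theorem kleinInvariant_neg (t : ℂ) : kleinInvariant (-t) = kleinInvariant t := by
  simp [kleinInvariant]

theorem kleinOrbit_ne_kleinOrbit (h : kleinInvariant s ≠ kleinInvariant t) (i j : Fin 4) :
    kleinOrbit s i ≠ kleinOrbit t j := fun e =>
  h (by rw [← kleinInvariant_kleinOrbit s i, e, kleinInvariant_kleinOrbit])

theorem kleinOrbit_ne (h : kleinInvariant s ≠ kleinInvariant t) (i : Fin 4) :
    kleinOrbit s i ≠ t :=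
  kleinOrbit_ne_kleinOrbit h i 0

theorem hasDerivAt_kleinInvariant (ht : t ≠ 0) :
    HasDerivAt kleinInvariant (2 * t + 2 / t ^ 3) t := by
  refine ((hasDerivAt_pow 2 t).sub ((hasDerivAt_pow 2 t).inv (pow_ne_zero 2 ht))).congr_deriv ?_
  norm_num only
  field_simp
  ring

theorem exists_kleinInvariant_eq (c : ℂ) : ∃ R, R ≠ 0 ∧ kleinInvariant R = c := by
  obtain ⟨R, hR⟩ := IsAlgClosed.exists_root (X ^ 4 - C c * X ^ 2 - 1 : ℂ[X])
    (by rw [show (X ^ 4 - C c * X ^ 2 - 1 : ℂ[X]).degree = 4 by compute_degree!]; decide)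
  replace hR : R ^ 4 - c * R ^ 2 - 1 = 0 := by simpa using hR
  have hR0 : R ≠ 0 := by
    rintro rfl
    norm_num at hR
  refine ⟨R, hR0, ?_⟩
  rw [kleinInvariant]
  field_simp
  linear_combination hR

theorem kleinInvariant_sq_of_pow_four_eq (h : t ^ 4 + 1 = 0) : kleinInvariant t ^ 2 = -4 := by
  have ht : t ≠ 0 := by
    rintro rfl
    norm_num at h
  rw [kleinInvariant]
  field_simp
  linear_combination (t ^ 4 + 1) * h

theorem pow_four_sub_kleinInvariant_mul_sq (ht : t ≠ 0) (c : ℂ) :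
    t ^ 4 - c * t ^ 2 - 1 = t ^ 2 * (kleinInvariant t - c) := by
  rw [kleinInvariant]
  field_simp
  ring

theorem inv_sub_add_inv_add {K : Type*} [Field K] {x y : K} (h : x ^ 2 ≠ y ^ 2) :
    (x - y)⁻¹ + (x + y)⁻¹ = 2 * x / (x ^ 2 - y ^ 2) := by
  have hsub : x - y ≠ 0 := sub_ne_zero.2 fun e => h (by rw [e])
  have hadd : x + y ≠ 0 := fun e => h (by rw [eq_neg_of_add_eq_zero_left e, neg_sq])
  rw [inv_add_inv hsub hadd, sq_sub_sq, mul_comm (x + y)]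
  ring

theorem sum_inv_sub_kleinOrbit (hR : R ≠ 0)
    (h : kleinInvariant t ≠ kleinInvariant R) :
    ∑ k, (t - kleinOrbit R k)⁻¹ =
      2 * t * (2 * t ^ 2 - kleinInvariant R) / (t ^ 4 - kleinInvariant R * t ^ 2 - 1) := by
  have hIR : (Complex.I / R) ^ 2 = -(R ^ 2)⁻¹ := by
    rw [div_pow, Complex.I_sq, neg_div, one_div]
  have hsq (k : Fin 4) : t ^ 2 ≠ kleinOrbit R k ^ 2 := fun e => h (by
    rw [← kleinInvariant_kleinOrbit R k, kleinInvariant, kleinInvariant, e])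
  have hsum : ∑ k, (t - kleinOrbit R k)⁻¹ = ((t - R)⁻¹ + (t + R)⁻¹) +
      ((t - Complex.I / R)⁻¹ + (t + Complex.I / R)⁻¹) := by
    simp only [Fin.sum_univ_four, kleinOrbit, Matrix.cons_val, sub_neg_eq_add]
    ring
  have h0 : t ^ 2 - R ^ 2 ≠ 0 := sub_ne_zero.2 (hsq 0)
  have h2 : t ^ 2 - (Complex.I / R) ^ 2 ≠ 0 := sub_ne_zero.2 (hsq 2)
  have hfactor : t ^ 4 - kleinInvariant R * t ^ 2 - 1 =
      (t ^ 2 - R ^ 2) * (t ^ 2 - (Complex.I / R) ^ 2) := by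
    rw [hIR, kleinInvariant]
    linear_combination mul_inv_cancel₀ (pow_ne_zero 2 hR)
  rw [hsum, inv_sub_add_inv_add (sub_ne_zero.1 h0), inv_sub_add_inv_add (sub_ne_zero.1 h2), hfactor,
    div_add_div _ _ h0 h2, hIR, kleinInvariant]
  ring

theorem sum_inv_sub_update_kleinOrbit (ht : t ≠ 0) (ht4 : t ^ 4 + 1 ≠ 0) (w : ℂ) :
    ∑ k, (t - Function.update (kleinOrbit t) 0 w k)⁻¹ =
      (t - w)⁻¹ + (5 * t ^ 4 + 1) / (2 * t * (t ^ 4 + 1)) := by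
  have hIt : (Complex.I / t) ^ 2 = -(t ^ 2)⁻¹ := by
    rw [div_pow, Complex.I_sq, neg_div, one_div]
  have hden : t ^ 2 - (Complex.I / t) ^ 2 = (t ^ 4 + 1) / t ^ 2 := by
    rw [hIt]
    field_simp
    ring
  have hsq : t ^ 2 ≠ (Complex.I / t) ^ 2 := by
    rw [← sub_ne_zero, hden]
    exact div_ne_zero ht4 (pow_ne_zero 2 ht)
  have hsum : ∑ k, (t - Function.update (kleinOrbit t) 0 w k)⁻¹ =
      (t - w)⁻¹ + ((t + t)⁻¹ + ((t - Complex.I / t)⁻¹ + (t + Complex.I / t)⁻¹)) := by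
    rw [← Finset.add_sum_erase _ _ (Finset.mem_univ 0), Function.update_self,
      show (Finset.univ.erase 0 : Finset (Fin 4)) = {1, 2, 3} from rfl]
    simp [kleinOrbit, add_comm, add_left_comm]
  rw [hsum, inv_sub_add_inv_add hsq, hden, ← two_mul]
  field_simp
  ring

/-- Denominator of the map induced on the orbits `kleinOrbit t` by the Jacobi variant for
`X ^ 4 - c * X ^ 2 - 1`. -/
noncomputable def kleinDen (c t : ℂ) : ℂ :=
  3 * t ^ 8 + c * t ^ 6 + 12 * t ^ 4 - 3 * c * t ^ 2 + 1

/-- The map induced on the orbits `kleinOrbit t` by the Jacobi variant for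
`X ^ 4 - c * X ^ 2 - 1`. -/
noncomputable def kleinMap (c t : ℂ) : ℂ :=
  t - 2 * t * (t ^ 4 + 1) * (t ^ 4 - c * t ^ 2 - 1) / kleinDen c t

theorem kleinDen_neg (c t : ℂ) : kleinDen c (-t) = kleinDen c t := by
  rw [kleinDen, kleinDen]
  ring

theorem kleinMap_neg (c t : ℂ) : kleinMap c (-t) = -kleinMap c t := by
  rw [kleinMap, kleinMap, kleinDen_neg]
  ring

/-- The configuration `kleinOrbit t` consists of four distinct points, none of them a root of
`X ^ 4 - c * X ^ 2 - 1`, and the value of `kleinMap c` at `t` is no division by zero. -/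
structure IsKleinRegular (c t : ℂ) : Prop where
  ne_zero : t ≠ 0
  pow_four_add_one_ne_zero : t ^ 4 + 1 ≠ 0
  kleinInvariant_ne : kleinInvariant t ≠ c
  kleinDen_ne_zero : kleinDen c t ≠ 0

theorem IsKleinRegular.neg (h : IsKleinRegular c t) : IsKleinRegular c (-t) where
  ne_zero := neg_ne_zero.2 h.ne_zero
  pow_four_add_one_ne_zero := by
    rw [Even.neg_pow (by decide)]
    exact h.pow_four_add_one_ne_zero
  kleinInvariant_ne := kleinInvariant_neg t ▸ h.kleinInvariant_ne
  kleinDen_ne_zero := kleinDen_neg c t ▸ h.kleinDen_ne_zero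

theorem IsKleinRegular.pow_four_sub_ne_zero (h : IsKleinRegular c t) :
    t ^ 4 - c * t ^ 2 - 1 ≠ 0 := by
  rw [pow_four_sub_kleinInvariant_mul_sq h.ne_zero]
  exact mul_ne_zero (pow_ne_zero 2 h.ne_zero) (sub_ne_zero.2 h.kleinInvariant_ne)

theorem IsKleinRegular.ne_kleinMap (h : IsKleinRegular c t) : t ≠ kleinMap c t := by
  rw [← sub_ne_zero, kleinMap, sub_sub_cancel]
  exact div_ne_zero (mul_ne_zero (mul_ne_zero (mul_ne_zero two_ne_zero h.ne_zero)
    h.pow_four_add_one_ne_zero) h.pow_four_sub_ne_zero) h.kleinDen_ne_zero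

theorem IsKleinRegular.aberthEq_zero (h : IsKleinRegular (kleinInvariant R) t) (hR : R ≠ 0) :
    AberthEq (kleinOrbit R) (kleinOrbit t) (kleinOrbit (kleinMap (kleinInvariant R) t)) 0 := by
  have ht := h.ne_zero
  have ht4 := h.pow_four_add_one_ne_zero
  have hP := h.pow_four_sub_ne_zero
  change ∑ k, (t - kleinOrbit R k)⁻¹ =
    ∑ k, (t - Function.update (kleinOrbit t) 0 (kleinMap (kleinInvariant R) t) k)⁻¹
  rw [sum_inv_sub_kleinOrbit hR h.kleinInvariant_ne, sum_inv_sub_update_kleinOrbit ht ht4,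
    kleinMap, sub_sub_cancel, inv_div, kleinDen, div_add_div _ _ (by simp [ht, ht4, hP])
      (by simp [ht, ht4]), div_eq_div_iff hP (by simp [ht, ht4, hP])]
  ring

theorem IsKleinRegular.aberthStep (h : IsKleinRegular c t) (hR : R ≠ 0)
    (hRc : kleinInvariant R = c) (hw : kleinMap c t ≠ 0) :
    AberthStep (kleinOrbit R) (kleinOrbit t) (kleinOrbit (kleinMap c t)) := by
  subst hRc
  set w := kleinMap (kleinInvariant R) t
  have hinj := kleinOrbit_injective h.ne_zero h.pow_four_add_one_ne_zero
  have hne_root := kleinOrbit_ne_kleinOrbit h.kleinInvariant_ne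
  have hne_next (i : Fin 4) : kleinOrbit t i ≠ kleinOrbit w i :=
    (kleinOrbit_apply_injective i).ne h.ne_kleinMap
  have hneg (i : Fin 4) (hi : AberthEq (kleinOrbit R) (kleinOrbit t) (kleinOrbit w) i) :
      AberthEq (kleinOrbit R) (kleinOrbit t) (kleinOrbit w) i.rev :=
    hi.of_mobius_symm (σ := Fin.revPerm) (a := -1) (b := 0) (c := 0) (e := 1) (by simp)
      (by simp) (by simp) (by simp) (by simp [mobius, neg_kleinOrbit])
      (by simp [mobius, neg_kleinOrbit]) (by simp [mobius, neg_kleinOrbit]) hinj (hne_root i)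
      (hne_next i)
  have hinv (i : Fin 4) (hi : AberthEq (kleinOrbit R) (kleinOrbit t) (kleinOrbit w) i) :
      AberthEq (kleinOrbit R) (kleinOrbit t) (kleinOrbit w) (i + 2) :=
    hi.of_mobius_symm (σ := Equiv.addRight 2) (a := 0) (b := Complex.I) (c := 1) (e := 0)
      (by simp) (by simpa using kleinOrbit_ne_zero hR)
      (by simpa using kleinOrbit_ne_zero h.ne_zero) (by simpa using kleinOrbit_ne_zero hw i)
      (by simp [mobius, I_div_kleinOrbit]) (by simp [mobius, I_div_kleinOrbit])
      (by simp [mobius, I_div_kleinOrbit]) hinj (hne_root i) (hne_next i)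
  have h0 := h.aberthEq_zero hR
  refine ⟨hinj, hne_root, hne_next, fun i => ?_⟩
  fin_cases i
  exacts [h0, hneg 2 (hinv 0 h0), hinv 0 h0, hneg 0 h0]

end KleinOrbit

section AttractingFixedPoint

theorem exists_iterate_tendsto_nhdsNE {𝕜 : Type*} [NontriviallyNormedField 𝕜] {f : 𝕜 → 𝕜}
    {f' a : 𝕜} (hf : HasDerivAt f f' a) (ha : f a = a) (h0 : f' ≠ 0) (h1 : ‖f'‖ < 1)
    {P : 𝕜 → Prop} (hP : ∀ᶠ x in 𝓝[≠] a, P x) :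
    ∃ x, (∀ n, P (f^[n] x)) ∧ Tendsto (fun n => f^[n] x) atTop (𝓝[≠] a) := by
  obtain ⟨θ, hθ, hθ1⟩ := exists_between h1
  have hθ0 : 0 ≤ θ := (norm_nonneg f').trans hθ.le
  have hslope := hasDerivAt_iff_tendsto_slope.1 hf
  have hcontract : ∀ᶠ x in 𝓝[≠] a, f x ≠ a ∧ dist (f x) a ≤ θ * dist x a := by
    filter_upwards [hslope.eventually_ne h0, hslope.norm.eventually_lt_const hθ,
      self_mem_nhdsWithin] with x hx0 hxθ hxa
    have hsub : f x - a = (x - a) * slope f a x := by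
      rw [← smul_eq_mul, sub_smul_slope, vsub_eq_sub, ha]
    refine ⟨sub_ne_zero.1 (hsub ▸ mul_ne_zero (sub_ne_zero.2 hxa) hx0), ?_⟩
    rw [dist_eq_norm, dist_eq_norm, hsub, norm_mul, mul_comm]
    gcongr
  obtain ⟨ε, hε, hball⟩ := Metric.mem_nhdsWithin_iff.1 (hP.and hcontract)
  have hmaps : Set.MapsTo f (Metric.ball a ε ∩ {a}ᶜ) (Metric.ball a ε ∩ {a}ᶜ) := fun x hx =>
    ⟨(hball hx).2.2.trans_lt ((mul_le_of_le_one_left dist_nonneg hθ1.le).trans_lt hx.1),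
      (hball hx).2.1⟩
  obtain ⟨x, hx⟩ := (NormedField.nhdsNE_neBot a).nonempty_of_mem
    (Filter.inter_mem (mem_nhdsWithin_of_mem_nhds (Metric.ball_mem_nhds a hε))
      self_mem_nhdsWithin)
  have hmem (n : ℕ) : f^[n] x ∈ Metric.ball a ε ∩ {a}ᶜ := hmaps.iterate n hx
  have hdist (n : ℕ) : dist (f^[n] x) a ≤ θ ^ n * dist x a := by
    induction n with
    | zero => simp
    | succ n ih =>
      rw [Function.iterate_succ_apply', pow_succ', mul_assoc]
      exact (hball (hmem n)).2.2.trans (mul_le_mul_of_nonneg_left ih hθ0)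
  refine ⟨x, fun n => (hball (hmem n)).1,
    tendsto_nhdsWithin_iff.2 ⟨?_, .of_forall fun n => (hmem n).2⟩⟩
  refine tendsto_iff_dist_tendsto_zero.2 (squeeze_zero (fun _ => dist_nonneg) hdist ?_)
  simpa using (tendsto_pow_atTop_nhds_zero_of_lt_one hθ0 hθ1).mul_const (dist x a)

end AttractingFixedPoint

section Quartic

/-- The value of `c` for which `kleinMap c` exchanges `2` and `-2`. -/
noncomputable def cycleParam : ℂ := -353 / 60

theorem kleinDen_cycleParam_two : kleinDen cycleParam 2 = 9826 / 15 := by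
  norm_num [kleinDen, cycleParam]

theorem kleinMap_cycleParam_two : kleinMap cycleParam 2 = -2 := by
  rw [kleinMap, kleinDen_cycleParam_two]
  norm_num [cycleParam]

theorem kleinInvariant_two_ne_cycleParam : kleinInvariant 2 ≠ cycleParam := by
  norm_num [kleinInvariant, cycleParam]

theorem hasDerivAt_kleinMap_cycleParam_two :
    HasDerivAt (kleinMap cycleParam) (99 / 289) 2 := by
  have hpow (k : ℕ) : HasDerivAt (fun t : ℂ => t ^ k) (k * 2 ^ (k - 1)) 2 := hasDerivAt_pow k 2
  have hnum : HasDerivAt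
      (fun t : ℂ => 2 * t * (t ^ 4 + 1) * (t ^ 4 - cycleParam * t ^ 2 - 1)) (150280 / 15) 2 :=
    ((((hasDerivAt_id' 2).const_mul 2).mul ((hpow 4).add_const 1)).mul
      (((hpow 4).sub ((hpow 2).const_mul cycleParam)).sub_const 1)).congr_deriv
      (by norm_num [cycleParam])
  have hden : HasDerivAt (kleinDen cycleParam) 2397 2 :=
    (((((hpow 8).const_mul 3).add ((hpow 6).const_mul cycleParam)).add
      ((hpow 4).const_mul 12)).sub ((hpow 2).const_mul (3 * cycleParam))).add_const 1
      |>.congr_deriv (by norm_num [cycleParam])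
  refine ((hasDerivAt_id' 2).sub (hnum.div hden ?_)).congr_deriv ?_
  · norm_num [kleinDen_cycleParam_two]
  · rw [kleinDen_cycleParam_two]
    norm_num [cycleParam]

theorem eventually_isKleinRegular_cycleParam :
    ∀ᶠ t in 𝓝 2, IsKleinRegular cycleParam t := by
  have hinvariant : ContinuousAt kleinInvariant 2 :=
    (hasDerivAt_kleinInvariant two_ne_zero).continuousAt
  have hden : ContinuousAt (kleinDen cycleParam) 2 := by
    unfold kleinDen
    fun_prop
  have hpow : ContinuousAt (fun t : ℂ => t ^ 4 + 1) 2 := by fun_prop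
  filter_upwards [eventually_ne_nhds two_ne_zero,
    hpow.eventually_ne (by norm_num : (2 : ℂ) ^ 4 + 1 ≠ 0),
    hinvariant.eventually_ne kleinInvariant_two_ne_cycleParam,
    hden.eventually_ne (by norm_num [kleinDen_cycleParam_two] : kleinDen cycleParam 2 ≠ 0)]
    with t hne hpow hinvariant hden
  exact ⟨hne, hpow, hinvariant, hden⟩

theorem eventually_kleinInvariant_ne_two :
    ∀ᶠ t in 𝓝[≠] 2, kleinInvariant t ≠ kleinInvariant 2 :=
  (hasDerivAt_kleinInvariant two_ne_zero).eventually_ne (by norm_num)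

theorem exists_kleinMap_orbit : ∃ t : ℕ → ℂ, (∀ n, t (n + 1) = kleinMap cycleParam (t n)) ∧
    (∀ n, IsKleinRegular cycleParam (t n)) ∧ (∀ n, kleinInvariant (t n) ≠ kleinInvariant 2) ∧
    Tendsto (fun n => (-1) ^ n * t n) atTop (𝓝[≠] 2) := by
  -- `kleinMap` is odd, so the 2-cycle `{2, -2}` is a fixed point of `-kleinMap`.
  obtain ⟨x, hx, hlim⟩ := exists_iterate_tendsto_nhdsNE (f := fun t => -kleinMap cycleParam t)
    hasDerivAt_kleinMap_cycleParam_two.neg (by simp [kleinMap_cycleParam_two]) (by norm_num)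
    (by norm_num)
    ((eventually_isKleinRegular_cycleParam.filter_mono nhdsWithin_le_nhds).and
      eventually_kleinInvariant_ne_two)
  set s : ℕ → ℂ := fun n => (fun t => -kleinMap cycleParam t)^[n] x
  have hs (n : ℕ) : s (n + 1) = -kleinMap cycleParam (s n) := Function.iterate_succ_apply' _ _ _
  refine ⟨fun n => (-1) ^ n * s n, fun n => ?_, fun n => ?_, fun n => ?_, ?_⟩
  · rcases neg_one_pow_eq_or ℂ n with h | h <;> simp [pow_succ, hs, h, kleinMap_neg]
  · rcases neg_one_pow_eq_or ℂ n with h | h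
    · simpa [h] using (hx n).1
    · simpa [h] using (hx n).1.neg
  · rcases neg_one_pow_eq_or ℂ n with h | h <;> simpa [h, kleinInvariant_neg] using (hx n).2
  · simpa [← mul_assoc, ← mul_pow] using hlim

theorem tendsto_norm_mobius_comp_kleinOrbit {t : ℕ → ℂ} {a : ℂ}
    (h : Tendsto (fun n => (-1) ^ n * t n) atTop (𝓝[≠] a)) :
    Tendsto (fun n => ‖mobius 0 1 1 (-a) ∘ kleinOrbit (t n)‖) atTop atTop := by
  have hsub : Tendsto (fun n => (-1) ^ n * t n - a) atTop (𝓝[≠] 0) :=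
    tendsto_nhdsWithin_iff.2 ⟨by
      simpa using (h.mono_right nhdsWithin_le_nhds).sub_const a,
      (h.eventually self_mem_nhdsWithin).mono fun n hn => sub_ne_zero.2 hn⟩
  have hcoord (n : ℕ) : ∃ k, kleinOrbit (t n) k = (-1) ^ n * t n := by
    rcases neg_one_pow_eq_or ℂ n with hn | hn
    · exact ⟨0, by simp [hn, kleinOrbit]⟩
    · exact ⟨3, by simp [hn, kleinOrbit]⟩
  refine tendsto_atTop_mono (fun n => ?_)
    (tendsto_norm_cobounded_atTop.comp (tendsto_inv₀_nhdsNE_zero.comp hsub))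
  obtain ⟨k, hk⟩ := hcoord n
  simpa [mobius, hk, sub_eq_add_neg] using
    norm_le_pi_norm (mobius 0 1 1 (-a) ∘ kleinOrbit (t n)) k

theorem exists_quartic_hasDivergentOrbit :
    ∃ p : ℂ[X], p.Monic ∧ p.natDegree = 4 ∧ p.roots.Nodup ∧ HasDivergentOrbit 4 p := by
  obtain ⟨R, hR, hRc⟩ := exists_kleinInvariant_eq cycleParam
  obtain ⟨t, hsucc, hreg, hpole, hlim⟩ := exists_kleinMap_orbit
  have hR4 : R ^ 4 + 1 ≠ 0 := fun h => by
    have := kleinInvariant_sq_of_pow_four_eq h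
    norm_num [hRc, cycleParam] at this
  have hdet : (0 * -2 - 1 * 1 : ℂ) ≠ 0 := by norm_num
  have hfinite {s : ℂ} (hs : kleinInvariant s ≠ kleinInvariant 2) (k : Fin 4) :
      1 * kleinOrbit s k + -2 ≠ 0 := by
    rw [one_mul, ← sub_eq_add_neg]
    exact sub_ne_zero.2 (kleinOrbit_ne hs k)
  have hRfinite := hfinite (hRc ▸ kleinInvariant_two_ne_cycleParam.symm)
  have hstep (n : ℕ) : AberthStep (mobius 0 1 1 (-2) ∘ kleinOrbit R)
      (mobius 0 1 1 (-2) ∘ kleinOrbit (t n)) (mobius 0 1 1 (-2) ∘ kleinOrbit (t (n + 1))) := by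
    refine AberthStep.mobius ?_ hdet hRfinite (hfinite (hpole n)) (hfinite (hpole (n + 1)))
    rw [hsucc]
    exact (hreg n).aberthStep hR hRc (hsucc n ▸ (hreg (n + 1)).ne_zero)
  have hinj : Function.Injective (mobius 0 1 1 (-2) ∘ kleinOrbit R) :=
    mobius_comp_injective hdet (kleinOrbit_injective hR hR4) hRfinite
  refine ⟨∏ k, (X - C ((mobius 0 1 1 (-2) ∘ kleinOrbit R) k)), monic_prod_X_sub_C _ _, ?_,
    nodup_roots (separable_prod_X_sub_C_iff.2 hinj), _, isJacobiOrbit_of_aberthStep hstep,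
    tendsto_norm_mobius_comp_kleinOrbit hlim⟩
  rw [natDegree_finsetProd_X_sub_C_eq_card, Finset.card_univ, Fintype.card_fin]

end Quartic

end EhrlichAberth

theorem theorem1 (d : ℕ) (hd : 4 ≤ d) :
    ∃ p : Polynomial ℂ, p.Monic ∧ p.natDegree = d ∧ p.roots.Nodup ∧
      ∃ z : ℕ → Fin d → ℂ, EhrlichAberth.IsJacobiOrbit p z ∧
        Filter.Tendsto (fun n => ‖z n‖) Filter.atTop Filter.atTop := by
  induction d, hd using Nat.le_induction with
  | base => exact EhrlichAberth.exists_quartic_hasDivergentOrbit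
  | succ d _ ih =>
    obtain ⟨p, hp, hdeg, hroots, hz⟩ := ih
    obtain ⟨a, ha, hz'⟩ := EhrlichAberth.HasDivergentOrbit.exists_mul_X_sub_C hz hp.ne_zero
    have hpa := hp.mul (monic_X_sub_C a)
    refine ⟨p * (X - C a), hpa, ?_, ?_, hz'⟩
    · rw [hp.natDegree_mul (monic_X_sub_C a), hdeg, natDegree_X_sub_C]
    · rw [roots_mul hpa.ne_zero, roots_X_sub_C, add_comm, Multiset.singleton_add,
        Multiset.nodup_cons]
      exact ⟨fun h => ha (isRoot_of_mem_roots h), hroots⟩
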